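/- Let $d\ge 1$, $n\ge 0$, let $U\in U(d)$ and let $|e\rangle=|e_1,\dots,e_n\rangle$ be a standard basis vector of $(\mathbb C^d)^{\otimes n}$. For $\pi\in S_n$ let $P_\pi$ be the operator permuting the tensor factors. For a partition $\lambda=(\lambda_1\ge\dots\ge\lambda_k>0)$ of $n$ with $k\le d$ parts, number the boxes of its Young diagram from left to right and then from top to bottom, let $A_\lambda,B_\lambda\subseteq S_n$ be the groups of permutations preserving the rows, respectively the columns, and put $Y_\lambda=\sum_{a\in A_\lambda}P_a\sum_{b\in B_\lambda}\mathrm{sgn}(b)P_b$, $\mathcal Q_\lambda=Y_\lambda(\mathbb C^d)^{\otimes n}$ and $\Pi^{(\lambda)}_{\rm sym}=\frac1{|A_\lambda|}\sum_{\pi\in A_\lambda}P_\pi$. For $w\in\mathbb N^d$ let $V(w)$ be the span of the standard basis vectors in which each symbol $i$ occurs exactly $w_i$ times. Nice Schur basis. For each $\lambda$, let $|(\lambda,0,0)\rangle,|(\lambda,1,0)\rangle,\dots$ be the concatenation of arbitrary orthonormal bases of the spaces $Y_\lambda V(w)$, with $w$ in reverse lexicographic order; extend $|(\lambda,0,0)\rangle$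 to an orthonormal basis $(|(\lambda,0,j)\rangle)_j$ of $\mathrm{span}\{P_\pi|(\lambda,0,0)\rangle:\pi\in S_n\}$; write $|(\lambda,0,j)\rangle=\sum_\pi\alpha^{(\lambda,j)}_\pi P_\pi|(\lambda,0,0)\rangle$ and set $|(\lambda,i,j)\rangle=\sum_\pi\alpha^{(\lambda,j)}_\pi P_\pi|(\lambda,i,0)\rangle$. Pre-processing. On input $U^{\otimes n}|e\rangle$, measure with the orthogonal projections $\Pi_{\lambda,j}$ onto $\mathrm{span}\{|(\lambda,i,j)\rangle: i\}$; on outcome $(\lambda,j)$ (of positive probability) apply the change of basis $H_{\lambda,j}$ that swaps $|(\lambda,i,0)\rangle$ and $|(\lambda,i,j)\rangle$ for all $i$ and fixes the other basis vectors; return $\lambda$ and the normalized state $H_{\lambda,j}\Pi_{\lambda,j}U^{\otimes n}|e\rangle$. Row symmetric measurement. Let $\mu_H$ be the distribution of $V|0\rangle\langle 0|V^\dagger$, where $|0\rangle$ is a fixed standard basis vector of $\mathbb C^d$ and $V\in U(d)$ is Haar random, and let $\kappa_s=\binom{s+d-1}{d-1}$. The measurement $\mathcal M^{(\lambda)}$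 is the POVM with elements $F^{(\lambda)}(\psi_1,\dots,\psi_k)=\bigotimes_{i=1}^k\kappa_{\lambda_i}\psi_i^{\otimes\lambda_i}$ with respect to $\mu_H^k$ (the factor $\psi_i^{\otimes \lambda_i}$ acting on the $i$-th row), together with a "fail" element $I-\Pi^{(\lambda)}_{\rm sym}$. On the outcome $(\psi_1,\dots,\psi_k)$ put $\Psi=\sum_{i=1}^k(d+\lambda_i)\psi_i$. Lemma. Suppose that the pre-processing on input $U^{\otimes n}|e\rangle$ outputs a partition $\lambda$ with exactly $k$ parts and the state $U^{\otimes n}|\tau\rangle$, and that $|\tau\rangle\in V(w)$. Then, when $\mathcal M^{(\lambda)}$ is performed on $U^{\otimes n}|\tau\rangle$, the Born rule defines a probability distribution of the outcome, "fail" has probability $0$, $\Psi$ is integrable, and $$\mathbb E[\Psi]=kI+\sum_{i=1}^d w_i\,U|i\rangle\langle i|U^\dagger ,$$ the expectation being over the randomness of the measurement. -/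

import Mathlib

open MeasureTheory

noncomputable section

namespace RowSym

/-! ### Qudits, weights and permutation operators -/

/-- The space `(ℂ^d)^{⊗n}`, with orthonormal standard basis `|a⟩` indexed by `a : Fin n → Fin d`. -/
abbrev Qudits (d n : ℕ) : Type := EuclideanSpace ℂ (Fin n → Fin d)

/-- Operators on `(ℂ^d)^{⊗n}`, as matrices in the standard basis. -/
abbrev QuditOp (d n : ℕ) : Type := Matrix (Fin n → Fin d) (Fin n → Fin d) ℂ

/-- The standard basis vector `|a⟩ = |a_1, …, a_n⟩`. -/
def ket {d n : ℕ} (a : Fin n → Fin d) : Qudits d n := EuclideanSpace.single a 1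

/-- The action of an operator on a vector. -/
abbrev act {d n : ℕ} (M : QuditOp d n) : Qudits d n →ₗ[ℂ] Qudits d n := Matrix.toEuclideanLin M

/-- The operator `M^{⊗n}`. -/
def tensorPow {d : ℕ} (n : ℕ) (M : Matrix (Fin d) (Fin d) ℂ) : QuditOp d n :=
  Matrix.of fun a b => ∏ q, M (a q) (b q)

/-- The permutation operator `P_π`, which sends `|b_1, …, b_n⟩` to
`|b_{π⁻¹(1)}, …, b_{π⁻¹(n)}⟩`. -/
def permOp {d n : ℕ} (π : Equiv.Perm (Fin n)) : QuditOp d n :=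
  Matrix.of fun a b => if a = b ∘ ⇑π⁻¹ then 1 else 0

/-- The weight vector of `|a⟩`: the number of occurrences of each symbol. -/
def weight {d n : ℕ} (a : Fin n → Fin d) : Fin d → ℕ :=
  fun i => (Finset.univ.filter fun q => a q = i).card

/-- The weight subspace `V(w)`. -/
def weightSpace {d : ℕ} (n : ℕ) (w : Fin d → ℕ) : Submodule ℂ (Qudits d n) :=
  Submodule.span ℂ {x | ∃ a : Fin n → Fin d, weight a = w ∧ x = ket a}

/-- The rank-one operator `|φ⟩⟨φ|`. -/
def stateMatrix {d n : ℕ} (φ : Qudits d n) : QuditOp d n :=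
  Matrix.vecMulVec (fun a => φ a) (fun b => star (φ b))

/-! ### Partitions and the Young symmetrizer -/

/-- A partition `λ ⊢_d n`: a weakly decreasing sequence of at most `d` positive integers that
sum up to `n`. -/
structure DPartition (d n : ℕ) where
  toComposition : Composition n
  antitone_blocks : Antitone toComposition.blocksFun
  length_le : toComposition.length ≤ d

namespace DPartition

variable {d n : ℕ}

/-- The number of parts of the partition. -/
abbrev length (lam : DPartition d n) : ℕ := lam.toComposition.length

/-- The `i`-th part, i.e. the length of the `i`-th row of the Young diagram. -/
abbrev part (lam : DPartition d n) (i : Fin lam.length) : ℕ := lam.toComposition.blocksFun i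

/-- The row of the `q`-th box, when the boxes of the Young diagram are numbered from left to
right and then from top to bottom. -/
abbrev row (lam : DPartition d n) (q : Fin n) : Fin lam.length := lam.toComposition.index q

/-- The column of the `q`-th box. -/
def col (lam : DPartition d n) (q : Fin n) : ℕ := (lam.toComposition.invEmbedding q : ℕ)

/-- The group `A_λ` of the permutations which preserve every row. -/
def rowPerms (lam : DPartition d n) : Finset (Equiv.Perm (Fin n)) :=
  Finset.univ.filter fun π => ∀ q, lam.row (π q) = lam.row q

/-- The group `B_λ` of the permutations which preserve every column. -/
def colPerms (lam : DPartition d n) : Finset (Equiv.Perm (Fin n)) :=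
  Finset.univ.filter fun π => ∀ q, lam.col (π q) = lam.col q

/-- The Young symmetrizer `Y_λ = (∑_{a ∈ A_λ} P_a) (∑_{b ∈ B_λ} sgn(b) P_b)`. -/
def youngSymmetrizer (lam : DPartition d n) : QuditOp d n :=
  (∑ a ∈ lam.rowPerms, permOp a) *
    ∑ b ∈ lam.colPerms, (((Equiv.Perm.sign b : ℤˣ) : ℤ) : ℂ) • permOp b

/-- The canonical irrep `Q_λ`, the image of the Young symmetrizer. -/
def canonicalIrrep (lam : DPartition d n) : Submodule ℂ (Qudits d n) :=
  LinearMap.range (act lam.youngSymmetrizer)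

/-- The dimension of `Q_λ`. -/
def dimQ (lam : DPartition d n) : ℕ := Module.finrank ℂ lam.canonicalIrrep

/-- The operator `Π_sym^{(λ)}`, the average of `P_π` over `π ∈ A_λ`. -/
def symProj (lam : DPartition d n) : QuditOp d n :=
  ((lam.rowPerms.card : ℂ))⁻¹ • ∑ π ∈ lam.rowPerms, permOp π

end DPartition

/-! ### The nice Schur basis -/

variable {d n : ℕ}

/-- The span of all `P_π x`. -/
def permSpan (x : Qudits d n) : Submodule ℂ (Qudits d n) :=
  Submodule.span ℂ (Set.range fun π : Equiv.Perm (Fin n) => act (permOp π) x)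

/-- A family of vectors `|(λ, i, j)⟩`, of which only those with `i < dim Q_λ` and `j < dim P_λ`
are used. -/
abbrev SchurFamily (d n : ℕ) : Type := DPartition d n → ℕ → ℕ → Qudits d n

/-- The dimension of the irrep `P_λ = span {P_π |(λ, 0, 0)⟩}` of the symmetric group. -/
def SchurFamily.dimP (v : SchurFamily d n) (lam : DPartition d n) : ℕ :=
  Module.finrank ℂ (permSpan (v lam 0 0))

/-- `v` is a possible output of the nice Schur basis algorithm (the algorithm chooses several
orthonormal bases arbitrarily). For each `λ`:
* the list of the `|(λ, i, 0)⟩` is a concatenation of orthonormal bases of the spaces `Y_λ V(w)`,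
  with `w` running through the weight vectors in reverse lexicographic order
  (`wt i` is the weight `w` from which `|(λ, i, 0)⟩` comes);
* the vectors `|(λ, 0, j)⟩` are an orthonormal basis of `span {P_π |(λ, 0, 0)⟩}`;
* with coefficients such that `|(λ, 0, j)⟩ = ∑_π α_π^{(j)} P_π |(λ, 0, 0)⟩`, one has
  `|(λ, i, j)⟩ = ∑_π α_π^{(j)} P_π |(λ, i, 0)⟩` for all `i`. -/
def IsNiceSchurBasis (v : SchurFamily d n) : Prop :=
  ∀ lam : DPartition d n,
    (∃ wt : ℕ → Fin d → ℕ,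
      (∀ i i', i ≤ i' → i' < lam.dimQ → toLex (wt i') ≤ toLex (wt i)) ∧
      ∀ w : Fin d → ℕ,
        Orthonormal ℂ (fun i : {i : ℕ // i < lam.dimQ ∧ wt i = w} => v lam i 0) ∧
        Submodule.span ℂ {x | ∃ i < lam.dimQ, wt i = w ∧ x = v lam i 0} =
          (weightSpace n w).map (act lam.youngSymmetrizer)) ∧
    (Orthonormal ℂ (fun j : Fin (v.dimP lam) => v lam 0 j) ∧
      Submodule.span ℂ (Set.range fun j : Fin (v.dimP lam) => v lam 0 j) =
        permSpan (v lam 0 0)) ∧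
    ∃ α : ℕ → Equiv.Perm (Fin n) → ℂ,
      ∀ j < v.dimP lam, ∀ i < lam.dimQ,
        v lam i j = ∑ π, α j π • act (permOp π) (v lam i 0)

/-! ### Generic pre-processing -/

/-- The span of the basis vectors `|(λ, ·, j)⟩`; the Schur projective measurement consists of the
orthogonal projections `Π_{λ,j}` onto these subspaces. -/
def schurBlock (v : SchurFamily d n) (lam : DPartition d n) (j : ℕ) :
    Submodule ℂ (Qudits d n) :=
  Submodule.span ℂ {x | ∃ i < lam.dimQ, x = v lam i j}

/-- `H` is the change of basis `H_{λ,j}`: it swaps `|(λ, i, 0)⟩` and `|(λ, i, j)⟩` for every `i`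
and fixes all the other basis vectors. -/
structure IsBasisSwap (v : SchurFamily d n) (lam : DPartition d n) (j : ℕ)
    (H : Qudits d n →ₗ[ℂ] Qudits d n) : Prop where
  map_zero : ∀ i < lam.dimQ, H (v lam i 0) = v lam i j
  map_self : ∀ i < lam.dimQ, H (v lam i j) = v lam i 0
  map_other : ∀ (mu : DPartition d n) (i l : ℕ), i < mu.dimQ → l < v.dimP mu →
    ¬ (mu = lam ∧ (l = 0 ∨ l = j)) → H (v mu i l) = v mu i l

/-- The generic pre-processing, run on the state `input`, returns with positive probability the
partition `λ` and the state `out`: some outcome `(λ, j)` of the Schur projective measurement with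
`Π_{λ,j} input ≠ 0` leads to the state `H_{λ,j} Π_{λ,j} input`, normalized to a unit vector. -/
def IsPreprocessingOutput (v : SchurFamily d n) (input : Qudits d n)
    (lam : DPartition d n) (out : Qudits d n) : Prop :=
  ∃ j < v.dimP lam, ∃ H : Qudits d n →ₗ[ℂ] Qudits d n, IsBasisSwap v lam j H ∧
    (schurBlock v lam j).starProjection input ≠ 0 ∧
    out = ((‖H ((schurBlock v lam j).starProjection input)‖⁻¹ : ℝ) : ℂ) •
      H ((schurBlock v lam j).starProjection input)

/-! ### Haar random pure states -/

instance instMeasurableSpaceMatrix (d : ℕ) : MeasurableSpace (Matrix (Fin d) (Fin d) ℂ) :=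
  inferInstanceAs (MeasurableSpace (Fin d → Fin d → ℂ))

instance instBorelSpaceMatrix (d : ℕ) : BorelSpace (Matrix (Fin d) (Fin d) ℂ) :=
  inferInstanceAs (BorelSpace (Fin d → Fin d → ℂ))

instance instCompactSpaceUnitaryGroup (d : ℕ) : CompactSpace (Matrix.unitaryGroup (Fin d) ℂ) := by
  refine (isCompact_iff_compactSpace
    (s := (Matrix.unitaryGroup (Fin d) ℂ : Set (Matrix (Fin d) (Fin d) ℂ)))).mp ?_
  have hK : IsCompact (Set.univ.pi fun _ : Fin d => Set.univ.pi fun _ : Fin d =>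
      Metric.closedBall (0 : ℂ) 1) :=
    isCompact_univ_pi fun _ => isCompact_univ_pi fun _ => isCompact_closedBall 0 1
  refine IsCompact.of_isClosed_subset (X := Matrix (Fin d) (Fin d) ℂ) hK ?_ ?_
  · have : ((Matrix.unitaryGroup (Fin d) ℂ : Set (Matrix (Fin d) (Fin d) ℂ))) =
        {A | A * star A = 1} := by
      ext A
      exact Matrix.mem_unitaryGroup_iff
    rw [this]
    exact isClosed_eq (by fun_prop) continuous_const
  · intro A hA
    exact Set.mem_univ_pi.mpr fun i => Set.mem_univ_pi.mpr fun j =>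
      mem_closedBall_zero_iff.mpr (entry_norm_bound_of_unitary hA i j)

/-- The Haar probability measure on the unitary group. -/
def haarUnitary (d : ℕ) : Measure (Matrix.unitaryGroup (Fin d) ℂ) :=
  Measure.haarMeasure ⊤

/-- The measure `μ_H`: the distribution of the density matrix `V |0⟩⟨0| V†` of a pure state,
for a Haar random unitary `V`. -/
def haarState (d : ℕ) [NeZero d] : Measure (Matrix (Fin d) (Fin d) ℂ) :=
  (haarUnitary d).map fun V : Matrix.unitaryGroup (Fin d) ℂ =>
    (V : Matrix (Fin d) (Fin d) ℂ) * Matrix.single 0 0 1 *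
      (V : Matrix (Fin d) (Fin d) ℂ).conjTranspose

/-! ### The row symmetric joint measurement and the estimator -/

/-- The dimension `κ_s` of the symmetric subspace of `s` qudits. -/
def kappa (d s : ℕ) : ℕ := (s + d - 1).choose (d - 1)

/-- The element `F^{(λ)}(ψ_1, …, ψ_k) = ⨂_i κ_{λ_i} ψ_i^{⊗ λ_i}`; the factor `ψ_i` acts on
the qudits of the `i`-th row of the Young diagram. -/
def rowPOVM (lam : DPartition d n) (ψ : Fin lam.length → Matrix (Fin d) (Fin d) ℂ) :
    QuditOp d n :=
  (∏ i, (kappa d (lam.part i) : ℂ)) •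
    Matrix.of fun a b => ∏ q, ψ (lam.row q) (a q) (b q)

/-- Outcomes of the measurement: matrices `(ψ_1, …, ψ_k)` or the outcome "fail". -/
abbrev Outcome (lam : DPartition d n) : Type :=
  (Fin lam.length → Matrix (Fin d) (Fin d) ℂ) ⊕ Unit

/-- The distribution (Born rule) of the outcome of the row symmetric joint measurement on the
state `|φ⟩`: density `tr(F^{(λ)}(ψ) |φ⟩⟨φ|)` with respect to the product Haar measure `μ_H^k`,
and probability `tr((I - Π_sym^{(λ)}) |φ⟩⟨φ|)` for "fail". -/
def outcomeLaw [NeZero d] (lam : DPartition d n) (φ : Qudits d n) : Measure (Outcome lam) :=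
  ((Measure.pi fun _ : Fin lam.length => haarState d).withDensity fun ψ =>
      ENNReal.ofReal (rowPOVM lam ψ * stateMatrix φ).trace.re).map Sum.inl +
    ENNReal.ofReal ((1 - lam.symProj) * stateMatrix φ).trace.re • Measure.dirac (Sum.inr ())

/-- The shadow matrix `Ψ = ∑_i (d + λ_i) ψ_i` (with the convention `0` for the outcome "fail"). -/
def shadow (lam : DPartition d n) : Outcome lam → Matrix (Fin d) (Fin d) ℂ
  | Sum.inl ψ => ∑ i, ((d : ℂ) + (lam.part i : ℂ)) • ψ i
  | Sum.inr _ => 0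

end RowSym

end

open RowSym

noncomputable section

namespace RowSym

/-! ### Moments of Haar random pure states -/

section HaarMoments

variable {d : ℕ}

/-! The pre-processing matters only through two facts: its output is a unit vector, and it lies in
`Q_λ` (`IsPreprocessingOutput.mem_and_norm`). Since `P_a Y_λ = Y_λ` for `a ∈ A_λ`, a vector `φ` of
`Q_λ` is invariant under row permutations, so `Π_sym` fixes it and "fail" has weight zero.

The analytic input is that `κ_s ∫ ψ^{⊗s} dμ_H` is the projection onto the symmetric subspace
(`ascFactorial_mul_moment`, `kappa_mul_moment`). Its engine is the recursion `moment_option`, in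
which the factor `d + s` removes one copy of `ψ`: multiplied by `d + s`, the `(s+1)`-st moment is
the `s`-th moment tensored with the identity, followed by the sum of the identity and the swaps of
the extra qudit with the others. The recursion follows from unitary invariance in Lie algebra form,
the rank one property and `tr ψ = 1`.

The estimator attaches an extra copy of `ψ_i` to row `i`. Its weight `d + λ_i` is exactly the factor
in the recursion, so `(d + λ_i) E[ψ_i]` is `I` plus the sum of the one-qudit reduced states of `φ`
over row `i` (`add_mul_integral_mul_trace_rowPOVM`). Summing over rows gives `kI` plus the sum of
all reduced states. For `φ = U^{⊗n} τ` the latter is conjugated by `U` from that of `τ`, and for `τ`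
of weight `w` it is diagonal with entries `w_i`, because altering one symbol leaves the weight space
(`localExpectation_of_mem_weightSpace`). -/

instance : IsProbabilityMeasure (haarUnitary d) :=
  ⟨by simpa [haarUnitary] using
    Measure.haarMeasure_self (K₀ := (⊤ : TopologicalSpace.PositiveCompacts
      (Matrix.unitaryGroup (Fin d) ℂ)))⟩

instance : (haarUnitary d).IsMulLeftInvariant := by
  unfold haarUnitary; infer_instance

variable [NeZero d]

/-- The density matrix `V |0⟩⟨0| V†`. -/
def pureState (V : Matrix.unitaryGroup (Fin d) ℂ) : Matrix (Fin d) (Fin d) ℂ :=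
  (V : Matrix (Fin d) (Fin d) ℂ) * Matrix.single 0 0 1 *
    (V : Matrix (Fin d) (Fin d) ℂ).conjTranspose

lemma pureState_apply (V : Matrix.unitaryGroup (Fin d) ℂ) (x y : Fin d) :
    pureState V x y = V.1 x 0 * star (V.1 y 0) := by
  rw [pureState, Matrix.mul_apply, Finset.sum_eq_single 0]
  · simp
  · intro b _ hb
    rw [Matrix.mul_single_apply_of_ne _ _ _ _ _ hb, zero_mul]
  · simp

lemma continuous_pureState : Continuous (pureState (d := d)) := by
  unfold pureState
  fun_prop

instance : IsProbabilityMeasure (haarState d) :=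
  Measure.isProbabilityMeasure_map continuous_pureState.measurable.aemeasurable

lemma integral_haarState {g : Matrix (Fin d) (Fin d) ℂ → ℂ} (hg : Continuous g) :
    ∫ ψ, g ψ ∂haarState d = ∫ V, g (pureState V) ∂haarUnitary d :=
  integral_map continuous_pureState.measurable.aemeasurable hg.measurable.aestronglyMeasurable

omit [NeZero d] in
lemma integrable_haarUnitary {g : Matrix.unitaryGroup (Fin d) ℂ → ℂ} (hg : Continuous g) :
    Integrable g (haarUnitary d) :=
  hg.integrable_of_hasCompactSupport (HasCompactSupport.of_compactSpace g)

lemma trace_pureState (V : Matrix.unitaryGroup (Fin d) ℂ) : ∑ x, pureState V x x = 1 := by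
  have h : ∑ x, star (V.1 x 0) * V.1 x 0 = 1 := by
    simpa [Matrix.mul_apply] using congrFun (congrFun (Unitary.coe_star_mul_self V) 0) 0
  simpa [pureState_apply, mul_comm] using h

variable {ι : Type*} [Fintype ι]

/-- The matrix entry of `∫ ψ^{⊗ι} dμ_H(ψ)` at `(a, b)`. -/
def moment (a b : ι → Fin d) : ℂ := ∫ ψ, ∏ q, ψ (a q) (b q) ∂haarState d

lemma moment_eq (a b : ι → Fin d) :
    moment a b = ∫ V, ∏ q, pureState V (a q) (b q) ∂haarUnitary d :=
  integral_haarState (by fun_prop)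

lemma continuous_prod_pureState (a b : ι → Fin d) :
    Continuous fun V : Matrix.unitaryGroup (Fin d) ℂ => ∏ q, pureState V (a q) (b q) :=
  continuous_finsetProd _ fun q _ => (continuous_pureState.matrix_elem (a q) (b q))

lemma integrable_prod_pureState (a b : ι → Fin d) :
    Integrable (fun V : Matrix.unitaryGroup (Fin d) ℂ => ∏ q, pureState V (a q) (b q))
      (haarUnitary d) :=
  integrable_haarUnitary (continuous_prod_pureState a b)

lemma moment_comp_equiv {κ : Type*} [Fintype κ] (e : κ ≃ ι) (a b : ι → Fin d) :
    moment (a ∘ e) (b ∘ e) = moment a b := by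
  unfold moment
  congr 1; ext ψ
  exact Equiv.prod_comp e fun q => ψ (a q) (b q)

variable [DecidableEq ι]

/-- With `ψ_V = V|0⟩⟨0|V†` one has `U ψ_V = ψ_{UV} U`. Taking tensor powers and integrating, left
invariance of Haar measure makes the moment operator commute with `U^{⊗ι}`. -/
lemma moment_unitary (U : Matrix.unitaryGroup (Fin d) ℂ) (a b : ι → Fin d) :
    ∑ c : ι → Fin d, (∏ q, U.1 (a q) (c q)) * moment c b =
      ∑ c : ι → Fin d, (∏ q, U.1 (c q) (b q)) * moment a c := by
  have key : ∀ V : Matrix.unitaryGroup (Fin d) ℂ,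
      ∑ c : ι → Fin d, (∏ q, U.1 (a q) (c q)) * ∏ q, pureState V (c q) (b q) =
        ∑ c : ι → Fin d, (∏ q, U.1 (c q) (b q)) * ∏ q, pureState (U * V) (a q) (c q) := by
    intro V
    simp_rw [← Finset.prod_mul_distrib]
    have h1 := Finset.prod_univ_sum (fun _ : ι => (Finset.univ : Finset (Fin d)))
      (fun q x => U.1 (a q) x * pureState V x (b q))
    have h2 := Finset.prod_univ_sum (fun _ : ι => (Finset.univ : Finset (Fin d)))
      (fun q x => U.1 x (b q) * pureState (U * V) (a q) x)
    rw [Fintype.piFinset_univ] at h1 h2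
    rw [← h1, ← h2]
    refine Finset.prod_congr rfl fun q _ => ?_
    have h3 : ∑ x, U.1 (a q) x * pureState V x (b q) = (U.1 * pureState V) (a q) (b q) :=
      (Matrix.mul_apply ..).symm
    have h4 : ∑ x, U.1 x (b q) * pureState (U * V) (a q) x =
        (pureState (U * V) * U.1) (a q) (b q) := by
      simp [Matrix.mul_apply, mul_comm]
    rw [h3, h4]
    have hU : U.1.conjTranspose * U.1 = 1 := Unitary.coe_star_mul_self U
    simp only [pureState, Submonoid.coe_mul, Matrix.conjTranspose_mul, Matrix.mul_assoc, hU,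
      Matrix.mul_one]
  have hint := fun c e => integrable_prod_pureState (d := d) (ι := ι) c e
  calc _ = ∫ V, ∑ c : ι → Fin d, (∏ q, U.1 (a q) (c q)) * ∏ q, pureState V (c q) (b q)
          ∂haarUnitary d := by
        rw [integral_finsetSum _ fun c _ => (hint c b).const_mul _]
        simp_rw [integral_const_mul, ← moment_eq]
    _ = ∫ V, ∑ c : ι → Fin d, (∏ q, U.1 (c q) (b q)) * ∏ q, pureState (U * V) (a q) (c q)
          ∂haarUnitary d := by simp_rw [key]
    _ = ∫ V, ∑ c : ι → Fin d, (∏ q, U.1 (c q) (b q)) * ∏ q, pureState V (a q) (c q)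
          ∂haarUnitary d :=
        integral_mul_left_eq_self (fun V => ∑ c : ι → Fin d, (∏ q, U.1 (c q) (b q)) *
          ∏ q, pureState V (a q) (c q)) U
    _ = _ := by
        rw [integral_finsetSum _ fun c _ => (hint a c).const_mul _]
        simp_rw [integral_const_mul, ← moment_eq]

-- The Kronecker deltas off `q` leave only the tuples that agree with `a` away from `q`. This is how
-- an operator acting on a single tensor factor appears in coordinates.
omit [NeZero d] in
lemma sum_prod_one_erase (q : ι) (a : ι → Fin d) (f : (ι → Fin d) → ℂ) :
    ∑ c : ι → Fin d, (∏ r ∈ Finset.univ.erase q, (1 : Matrix (Fin d) (Fin d) ℂ) (a r) (c r)) * f c =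
      ∑ x, f (Function.update a q x) := by
  rw [← Finset.sum_subset (Finset.subset_univ
      (Finset.univ.image fun x => Function.update a q x)), Finset.sum_image]
  · refine Finset.sum_congr rfl fun x _ => ?_
    rw [Finset.prod_eq_one, one_mul]
    intro r hr
    rw [Function.update_of_ne (Finset.ne_of_mem_erase hr), Matrix.one_apply_eq]
  · intro x _ y _ h
    simpa using congrFun h q
  · intro c _ hc
    have : ∃ r, r ≠ q ∧ a r ≠ c r := by
      by_contra! h
      refine hc (Finset.mem_image.mpr ⟨c q, Finset.mem_univ _, ?_⟩)
      ext r
      rcases eq_or_ne r q with rfl | hr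
      · simp
      · simp [hr, h r hr]
    obtain ⟨r, hr, hne⟩ := this
    exact mul_eq_zero_of_left (Finset.prod_eq_zero
      (f := fun r => (1 : Matrix (Fin d) (Fin d) ℂ) (a r) (c r))
      (Finset.mem_erase.mpr ⟨hr, Finset.mem_univ _⟩) (Matrix.one_apply_ne hne)) _

/-! ### Infinitesimal unitary invariance -/

section

attribute [local instance] Matrix.linftyOpNormedRing Matrix.linftyOpNormedAlgebra

omit [NeZero d] in
lemma hasDerivAt_exp_smul_apply (X : Matrix (Fin d) (Fin d) ℂ) (x y : Fin d) :
    HasDerivAt (fun t : ℝ => NormedSpace.exp (t • X) x y) (X x y) 0 := by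
  have h := hasDerivAt_exp_smul_const (𝕂 := ℝ) X 0
  rw [zero_smul, NormedSpace.exp_zero, one_mul] at h
  exact hasDerivAt_pi.mp (hasDerivAt_pi.mp h x) y

omit [NeZero d] in
lemma exp_smul_mem_unitaryGroup {X : Matrix (Fin d) (Fin d) ℂ} (hX : X.conjTranspose = -X)
    (t : ℝ) : NormedSpace.exp (t • X) ∈ Matrix.unitaryGroup (Fin d) ℂ := by
  rw [Matrix.mem_unitaryGroup_iff, Matrix.star_eq_conjTranspose, ← Matrix.exp_conjTranspose,
    Matrix.conjTranspose_smul, hX, star_trivial, smul_neg, ← Matrix.exp_add_of_commute _ _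
      (Commute.refl (t • X)).neg_right, add_neg_cancel, NormedSpace.exp_zero]

omit [NeZero d] in
lemma hasDerivAt_sum_prod_exp (X : Matrix (Fin d) (Fin d) ℂ) (a : ι → Fin d)
    (f : (ι → Fin d) → ℂ) :
    HasDerivAt (fun t : ℝ => ∑ c : ι → Fin d, (∏ q, NormedSpace.exp (t • X) (a q) (c q)) * f c)
      (∑ q, ∑ x, X (a q) x * f (Function.update a q x)) 0 := by
  have h : HasDerivAt
      (fun t : ℝ => ∑ c : ι → Fin d, (∏ q, NormedSpace.exp (t • X) (a q) (c q)) * f c)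
      (∑ c : ι → Fin d, (∑ q, (∏ r ∈ Finset.univ.erase q,
        NormedSpace.exp ((0 : ℝ) • X) (a r) (c r)) • X (a q) (c q)) * f c) 0 :=
    HasDerivAt.fun_sum fun c _ => (HasDerivAt.fun_finsetProd fun q _ =>
      hasDerivAt_exp_smul_apply X (a q) (c q)).mul_const (f c)
  convert h using 1
  simp only [zero_smul, NormedSpace.exp_zero, Finset.sum_mul, smul_eq_mul, mul_assoc]
  conv_rhs => rw [Finset.sum_comm]
  refine Finset.sum_congr rfl fun q _ => ?_
  have h2 : ∑ x, X (a q) x * f (Function.update a q x) =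
      ∑ x, X (a q) (Function.update a q x q) * f (Function.update a q x) := by simp
  exact h2.trans (sum_prod_one_erase q a fun c => X (a q) (c q) * f c).symm

omit [NeZero d] in
lemma hasDerivAt_sum_prod_exp' (X : Matrix (Fin d) (Fin d) ℂ) (b : ι → Fin d)
    (f : (ι → Fin d) → ℂ) :
    HasDerivAt (fun t : ℝ => ∑ c : ι → Fin d, (∏ q, NormedSpace.exp (t • X) (c q) (b q)) * f c)
      (∑ q, ∑ x, X x (b q) * f (Function.update b q x)) 0 := by
  have h := hasDerivAt_sum_prod_exp X.transpose b f
  simpa only [← Matrix.transpose_smul, Matrix.exp_transpose, Matrix.transpose_apply] using h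

end

/-- The commutation relation for the unitaries `exp(tX)` is differentiated at `t = 0`, so that only
one tensor factor at a time is affected. -/
lemma moment_skew {X : Matrix (Fin d) (Fin d) ℂ} (hX : X.conjTranspose = -X) (a b : ι → Fin d) :
    ∑ q, ∑ x, X (a q) x * moment (Function.update a q x) b =
      ∑ q, ∑ x, X x (b q) * moment a (Function.update b q x) := by
  refine (hasDerivAt_sum_prod_exp X a fun c => moment c b).unique ?_
  have h : (fun t : ℝ => ∑ c : ι → Fin d, (∏ q, NormedSpace.exp (t • X) (a q) (c q)) *
      moment c b) =
      fun t : ℝ => ∑ c : ι → Fin d, (∏ q, NormedSpace.exp (t • X) (c q) (b q)) * moment a c :=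
    funext fun t => moment_unitary ⟨_, exp_smul_mem_unitaryGroup hX t⟩ a b
  rw [h]
  exact hasDerivAt_sum_prod_exp' X b (moment a)

/-- Both sides are complex linear in `X`, and every matrix is a complex combination of
skew-Hermitian ones. This makes matrix units admissible. -/
lemma moment_lie (X : Matrix (Fin d) (Fin d) ℂ) (a b : ι → Fin d) :
    ∑ q, ∑ x, X (a q) x * moment (Function.update a q x) b =
      ∑ q, ∑ x, X x (b q) * moment a (Function.update b q x) := by
  let L : Matrix (Fin d) (Fin d) ℂ →ₗ[ℂ] ℂ :=
    { toFun := fun X => ∑ q, ∑ x, X (a q) x * moment (Function.update a q x) b -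
        ∑ q, ∑ x, X x (b q) * moment a (Function.update b q x)
      map_add' := fun X Y => by
        simp only [Matrix.add_apply, add_mul, Finset.sum_add_distrib]; ring
      map_smul' := fun c X => by
        simp only [Matrix.smul_apply, smul_eq_mul, mul_assoc, ← Finset.mul_sum, mul_sub,
          RingHom.id_apply] }
  have hL : ∀ Y : Matrix (Fin d) (Fin d) ℂ, Y.conjTranspose = -Y → L Y = 0 := fun Y hY =>
    sub_eq_zero.mpr (moment_skew hY a b)
  -- `X` is half the sum of `X - X†` and `X + X†`; the former is skew-Hermitian, the latter becomes
  -- so after multiplication by `i`.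
  have h1 := hL (X - X.conjTranspose) (by simp)
  have h2 := hL (Complex.I • (X + X.conjTranspose)) (by
    rw [Matrix.conjTranspose_smul]
    simp [add_comm])
  rw [map_smul, smul_eq_mul, mul_eq_zero, or_iff_right Complex.I_ne_zero, map_add] at h2
  rw [map_sub] at h1
  have h3 : L X = 0 := by linear_combination (h1 + h2) / 2
  exact sub_eq_zero.mp h3

lemma moment_lie_single (i j : Fin d) (a b : ι → Fin d) :
    ∑ q, (if a q = i then moment (Function.update a q j) b else 0) =
      ∑ q, if b q = j then moment a (Function.update b q i) else 0 := by
  have h := moment_lie (Matrix.single i j 1) a b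
  simp only [Matrix.single_apply, ite_mul, one_mul, zero_mul, eq_comm (a := i), eq_comm (a := j),
    ite_and] at h
  simpa using h

/-! ### The recursion and the closed formula for the moments -/

-- Since `ψ` has rank one, the integrand splits into a product over the row indices and a product
-- over the column indices, so each set can be permuted independently.
omit [DecidableEq ι] in
lemma moment_comp_perm (σ : Equiv.Perm ι) (a b : ι → Fin d) :
    moment (a ∘ σ) b = moment a b := by
  simp_rw [moment_eq, pureState_apply, Finset.prod_mul_distrib]
  congr 1; funext V
  congr 1
  exact Equiv.prod_comp σ fun q => V.1 (a q) 0

omit [DecidableEq ι] in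
lemma moment_comp_perm_right (σ : Equiv.Perm ι) (a b : ι → Fin d) :
    moment a (b ∘ σ) = moment a b := by
  rw [← moment_comp_perm σ, moment_comp_equiv]

/-- Tracing out the extra factor `none` costs nothing because `tr ψ = 1`. -/
lemma sum_moment_option (a b : Option ι → Fin d) :
    ∑ c, moment (Function.update a none c) (Function.update b none c) =
      moment (a ∘ some) (b ∘ some) := by
  simp_rw [moment_eq]
  rw [← integral_finsetSum _ fun c _ => integrable_prod_pureState _ _]
  congr 1; funext V
  simp [Fintype.prod_option, ← Finset.sum_mul, trace_pureState]

/-- The Lie identity for the matrix units `|b none⟩⟨c|`, with `c` placed in the column slot `none`,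
is summed over `c`. On the left the sum becomes a trace over one factor; on the right every term
reduces to `moment a b`, with total multiplicity `d` from `none` and one from each element of `ι`.
-/
lemma moment_option (a b : Option ι → Fin d) :
    ((d : ℂ) + Fintype.card ι) * moment a b =
      ∑ o, if a o = b none then
        moment ((a ∘ Equiv.swap none o) ∘ some) (b ∘ some) else 0 := by
  have h := Finset.sum_congr rfl fun c (_ : c ∈ Finset.univ) =>
    moment_lie_single (b none) c a (Function.update b none c)
  rw [Finset.sum_comm, Finset.sum_comm (s := Finset.univ (α := Fin d))] at h
  have hl : ∀ o, ∑ c, (if a o = b none then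
        moment (Function.update a o c) (Function.update b none c) else 0) =
      if a o = b none then moment ((a ∘ Equiv.swap none o) ∘ some) (b ∘ some) else 0 := by
    intro o
    split_ifs
    · rw [← sum_moment_option]
      refine Finset.sum_congr rfl fun c _ => ?_
      -- Permuting the row indices alone brings the updated slot `o` to `none`, where it meets the
      -- column index `c`.
      rw [← moment_comp_perm (Equiv.swap none o) (Function.update a o c),
        Function.update_comp_equiv, Equiv.symm_swap, Equiv.swap_apply_right]
    · simp
  rw [← Finset.sum_congr rfl fun o _ => hl o, h, Fintype.sum_option]
  have hr : ∀ q : ι, ∑ c, (if Function.update b none c (some q) = c then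
        moment a (Function.update (Function.update b none c) (some q) (b none)) else 0) =
      moment a b := by
    intro q
    -- Only `c = b (some q)` survives, and the two updates then exchange the entries of `b` at
    -- `none` and `some q`.
    rw [← moment_comp_perm_right (Equiv.swap none (some q)) a b]
    simp only [Function.update_of_ne (Option.some_ne_none q), Finset.sum_ite_eq,
      Finset.mem_univ, if_true]
    congr 1
    funext o
    rcases o with _ | r
    · simp
    · rcases eq_or_ne r q with rfl | hr
      · simp
      · simp [hr, Equiv.swap_apply_of_ne_of_ne]
  rw [Finset.sum_congr rfl fun q _ => hr q]
  simp [add_mul]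

/-- Induction on the size of `ι`: the recursion peels off one factor, just as a permutation of
`Option ι` is determined by the image of `none` and a permutation of `ι`. -/
lemma ascFactorial_mul_moment (a b : ι → Fin d) :
    ((d.ascFactorial (Fintype.card ι) : ℕ) : ℂ) * moment a b =
      ∑ π : Equiv.Perm ι, if a ∘ π = b then 1 else 0 := by
  revert a b
  rename_i inst
  revert inst
  refine Fintype.induction_empty_option (P := fun ι _ => ∀ [DecidableEq ι] (a b : ι → Fin d),
    ((d.ascFactorial (Fintype.card ι) : ℕ) : ℂ) * moment a b =
      ∑ π : Equiv.Perm ι, if a ∘ π = b then 1 else 0) ?_ ?_ ?_ ι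
  · intro ι κ _ e ih _ a b
    classical
    let _ : Fintype ι := Fintype.ofEquiv κ e.symm
    have h := ih (a ∘ e) (b ∘ e)
    rw [moment_comp_equiv, Fintype.card_congr e] at h
    rw [h]
    refine Fintype.sum_equiv e.permCongr _ _ fun π => ?_
    refine if_congr ?_ rfl rfl
    rw [← e.surjective.injective_comp_right.eq_iff]
    refine Eq.congr ?_ rfl
    funext q
    simp
  · intro _ a b
    simp [moment, eq_iff_true_of_subsingleton]
  · intro ι _ ih _ a b
    classical
    rw [Fintype.card_option, Nat.ascFactorial_succ]
    push_cast
    rw [mul_right_comm, moment_option, Finset.sum_mul,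
      ← Equiv.sum_comp Equiv.Perm.decomposeOption.symm, Fintype.sum_prod_type]
    refine Finset.sum_congr rfl fun o _ => ?_
    rw [ite_mul, zero_mul, mul_comm, ih]
    split_ifs with ho
    · refine Finset.sum_congr rfl fun σ _ => if_congr ?_ rfl rfl
      simp only [funext_iff, Option.forall]
      simp [ho]
    · refine (Finset.sum_eq_zero fun σ _ => if_neg fun h => ho ?_).symm
      simpa using congrFun h none

lemma kappa_mul_factorial (s : ℕ) : kappa d s * s.factorial = d.ascFactorial s := by
  obtain ⟨m, rfl⟩ : ∃ m, d = m + 1 := Nat.exists_eq_succ_of_ne_zero (NeZero.ne d)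
  rw [Nat.ascFactorial_eq_factorial_mul_choose, kappa, mul_comm]
  congr 1
  rw [show s + (m + 1) - 1 = m + s by omega, Nat.add_sub_cancel]
  exact Nat.choose_symm_add

lemma kappa_mul_moment (a b : ι → Fin d) :
    (kappa d (Fintype.card ι) : ℂ) * moment a b =
      ((Fintype.card ι).factorial : ℂ)⁻¹ * ∑ π : Equiv.Perm ι, if a ∘ π = b then 1 else 0 := by
  have h : ((Fintype.card ι).factorial : ℂ) ≠ 0 := by exact_mod_cast Nat.factorial_ne_zero _
  rw [← ascFactorial_mul_moment, ← kappa_mul_factorial]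
  push_cast
  field_simp

end HaarMoments

/-! ### Row symmetry of the canonical irrep -/

section Operators

variable {d n : ℕ}

lemma act_apply (M : QuditOp d n) (x : Qudits d n) (a : Fin n → Fin d) :
    act M x a = ∑ b, M a b * x b := rfl

lemma act_mul (M N : QuditOp d n) (x : Qudits d n) : act (M * N) x = act M (act N x) := by
  ext a
  simp only [act_apply, Matrix.mul_apply, Finset.sum_mul, Finset.mul_sum, mul_assoc]
  exact Finset.sum_comm

lemma act_permOp (π : Equiv.Perm (Fin n)) (x : Qudits d n) (a : Fin n → Fin d) :
    act (permOp π) x a = x (a ∘ π) := by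
  rw [act_apply, Finset.sum_eq_single (a ∘ π)]
  · rw [permOp, Matrix.of_apply, if_pos (by ext; simp), one_mul]
  · intro b _ hb
    rw [permOp, Matrix.of_apply, if_neg, zero_mul]
    rintro rfl
    exact hb (by ext; simp)
  · simp

lemma act_injective : Function.Injective (act : QuditOp d n → _) :=
  Matrix.toEuclideanLin.injective

lemma permOp_mul_permOp (π σ : Equiv.Perm (Fin n)) :
    (permOp (π * σ) : QuditOp d n) = permOp π * permOp σ := by
  refine act_injective (LinearMap.ext fun x => ?_)
  ext a
  rw [act_mul, act_permOp, act_permOp, act_permOp]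
  rfl

lemma DPartition.mul_mem_rowPerms (lam : DPartition d n) {π σ : Equiv.Perm (Fin n)}
    (hπ : π ∈ lam.rowPerms) : π * σ ∈ lam.rowPerms ↔ σ ∈ lam.rowPerms := by
  simp only [rowPerms, Finset.mem_filter, Finset.mem_univ, true_and] at hπ ⊢
  simp [hπ]

/-- The row sum is the leftmost factor of `Y_λ`, and left multiplication by `π` merely reindexes it.
-/
lemma permOp_mul_youngSymmetrizer (lam : DPartition d n) {π : Equiv.Perm (Fin n)}
    (hπ : π ∈ lam.rowPerms) : permOp π * lam.youngSymmetrizer = lam.youngSymmetrizer := by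
  rw [DPartition.youngSymmetrizer, ← mul_assoc]
  congr 1
  rw [Finset.mul_sum]
  simp_rw [← permOp_mul_permOp]
  exact Finset.sum_equiv (Equiv.mulLeft π)
    (fun σ => (lam.mul_mem_rowPerms hπ).symm) fun _ _ => rfl

lemma apply_comp_of_mem_canonicalIrrep {lam : DPartition d n} {φ : Qudits d n}
    (hφ : φ ∈ lam.canonicalIrrep) {π : Equiv.Perm (Fin n)} (hπ : π ∈ lam.rowPerms)
    (a : Fin n → Fin d) : φ (a ∘ π) = φ a := by
  obtain ⟨x, rfl⟩ := hφ
  rw [← act_permOp, ← act_mul, permOp_mul_youngSymmetrizer lam hπ]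

lemma act_symProj {lam : DPartition d n} {φ : Qudits d n}
    (hφ : ∀ π ∈ lam.rowPerms, ∀ a, φ (a ∘ π) = φ a) : act lam.symProj φ = φ := by
  have hcard : (lam.rowPerms.card : ℂ) ≠ 0 := by
    rw [Nat.cast_ne_zero, Finset.card_ne_zero]
    exact ⟨1, by simp [DPartition.rowPerms]⟩
  have h : ∑ π ∈ lam.rowPerms, act (permOp π) φ = (lam.rowPerms.card : ℂ) • φ := by
    rw [Finset.sum_congr rfl fun π hπ => (by ext a; rw [act_permOp, hφ π hπ] :
      act (permOp π) φ = φ), Finset.sum_const, Nat.cast_smul_eq_nsmul]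
  rw [DPartition.symProj, act, map_smul, map_sum, LinearMap.smul_apply, LinearMap.sum_apply]
  exact (congrArg _ h).trans (inv_smul_smul₀ hcard φ)

lemma one_sub_symProj_mul_stateMatrix {lam : DPartition d n} {φ : Qudits d n}
    (hφ : ∀ π ∈ lam.rowPerms, ∀ a, φ (a ∘ π) = φ a) :
    (1 - lam.symProj) * stateMatrix φ = 0 := by
  rw [stateMatrix, Matrix.mul_vecMulVec, Matrix.sub_mulVec, Matrix.one_mulVec]
  have h : lam.symProj.mulVec (fun a => φ a) = fun a => φ a :=
    funext fun a => congrArg (fun x : Qudits d n => x a) (act_symProj hφ)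
  rw [h, sub_self, Matrix.zero_vecMulVec]

/-! ### Outputs of the pre-processing -/

lemma span_ket : Submodule.span ℂ (Set.range (ket : (Fin n → Fin d) → Qudits d n)) = ⊤ := by
  have h : (ket : (Fin n → Fin d) → Qudits d n) =
      (EuclideanSpace.basisFun (Fin n → Fin d) ℂ).toBasis := by
    funext a
    simp [ket]
  rw [h]
  exact (EuclideanSpace.basisFun (Fin n → Fin d) ℂ).toBasis.span_eq

/-- The standard basis splits the whole space into weight spaces, so the images `Y_λ V(w)` together
span `Q_λ`. -/
lemma IsNiceSchurBasis.span_eq {v : SchurFamily d n} (hv : IsNiceSchurBasis v)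
    (lam : DPartition d n) :
    Submodule.span ℂ (Set.range fun i : Fin lam.dimQ => v lam i 0) = lam.canonicalIrrep := by
  obtain ⟨⟨wt, -, hw⟩, -⟩ := hv lam
  apply le_antisymm
  · rw [Submodule.span_le]
    rintro _ ⟨i, rfl⟩
    have h : v lam i 0 ∈ (weightSpace n (wt i)).map (act lam.youngSymmetrizer) := by
      rw [← (hw (wt i)).2]
      exact Submodule.subset_span ⟨i, i.2, rfl, rfl⟩
    obtain ⟨x, -, hx⟩ := h
    exact ⟨x, hx⟩
  · rw [DPartition.canonicalIrrep, LinearMap.range_eq_map, ← span_ket, Submodule.map_span,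
      Submodule.span_le]
    rintro _ ⟨_, ⟨a, rfl⟩, rfl⟩
    have h : act lam.youngSymmetrizer (ket a) ∈
        (weightSpace n (weight a)).map (act lam.youngSymmetrizer) :=
      Submodule.mem_map_of_mem (Submodule.subset_span ⟨a, rfl, rfl⟩)
    rw [← (hw (weight a)).2] at h
    refine Submodule.span_mono ?_ h
    rintro _ ⟨i, hi, -, rfl⟩
    exact ⟨⟨i, hi⟩, rfl⟩

/-- A spanning family with as many members as the dimension is independent. -/
lemma IsNiceSchurBasis.linearIndependent {v : SchurFamily d n} (hv : IsNiceSchurBasis v)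
    (lam : DPartition d n) : LinearIndependent ℂ fun i : Fin lam.dimQ => v lam i 0 := by
  rw [linearIndependent_iff_card_eq_finrank_span, Set.finrank, hv.span_eq, Fintype.card_fin]
  rfl

/-- `H` carries the block `j` to the block `0`, whose span is `Q_λ`. -/
lemma IsPreprocessingOutput.mem_and_norm {v : SchurFamily d n} (hv : IsNiceSchurBasis v)
    {input : Qudits d n} {lam : DPartition d n} {out : Qudits d n}
    (h : IsPreprocessingOutput v input lam out) : out ∈ lam.canonicalIrrep ∧ ‖out‖ = 1 := by
  obtain ⟨j, -, H, hH, hne, rfl⟩ := h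
  have hmem := Submodule.starProjection_apply_mem (schurBlock v lam j) input
  generalize (schurBlock v lam j).starProjection input = y at hne hmem
  have hrange : {x | ∃ i < lam.dimQ, x = v lam i j} =
      Set.range fun i : Fin lam.dimQ => v lam i j := by
    ext x
    constructor
    · rintro ⟨i, hi, rfl⟩
      exact ⟨⟨i, hi⟩, rfl⟩
    · rintro ⟨i, rfl⟩
      exact ⟨i, i.2, rfl⟩
  rw [schurBlock, hrange, Submodule.mem_span_range_iff_exists_fun] at hmem
  obtain ⟨c, rfl⟩ := hmem
  have hHy : H (∑ i, c i • v lam i j) = ∑ i : Fin lam.dimQ, c i • v lam i 0 := by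
    rw [map_sum]
    exact Finset.sum_congr rfl fun i _ => by rw [map_smul, hH.map_self i i.2]
  -- Independence of the `|(λ, i, 0)⟩` keeps `H` from annihilating the projected state, so the
  -- normalization does not divide by zero.
  have hHne : H (∑ i, c i • v lam i j) ≠ 0 := by
    rw [hHy]
    intro h0
    refine hne (Finset.sum_eq_zero fun i _ => ?_)
    rw [Fintype.linearIndependent_iff.mp (hv.linearIndependent lam) c h0 i, zero_smul]
  constructor
  · refine Submodule.smul_mem _ _ ?_
    rw [hHy, ← hv.span_eq]
    exact Submodule.sum_mem _ fun i _ => Submodule.smul_mem _ _ (Submodule.subset_span ⟨i, rfl⟩)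
  · rw [norm_smul, Complex.norm_real, norm_inv, norm_norm,
      inv_mul_cancel₀ (norm_ne_zero_iff.mpr hHne)]

/-! ### Sums of one-qudit expectation values -/

/-- The operator `⨂_q M_q`. -/
def tensorFamily (M : Fin n → Matrix (Fin d) (Fin d) ℂ) : QuditOp d n :=
  Matrix.of fun a b => ∏ q, M q (a q) (b q)

lemma tensorFamily_mul (M N : Fin n → Matrix (Fin d) (Fin d) ℂ) :
    tensorFamily M * tensorFamily N = tensorFamily fun q => M q * N q := by
  ext a b
  have h := Finset.prod_univ_sum (fun _ : Fin n => (Finset.univ : Finset (Fin d)))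
    (fun q x => M q (a q) x * N q x (b q))
  rw [Fintype.piFinset_univ] at h
  simp only [tensorFamily, Matrix.mul_apply, Matrix.of_apply, h, Finset.prod_mul_distrib]

lemma tensorFamily_one : tensorFamily (fun _ => 1 : Fin n → Matrix (Fin d) (Fin d) ℂ) = 1 := by
  ext a b
  simp only [tensorFamily, Matrix.of_apply, Matrix.one_apply, Finset.prod_ite_zero,
    Finset.prod_const_one, funext_iff, Finset.mem_univ, true_imp_iff]

lemma tensorFamily_conjTranspose (M : Fin n → Matrix (Fin d) (Fin d) ℂ) :
    (tensorFamily M).conjTranspose = tensorFamily fun q => (M q).conjTranspose := by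
  ext a b
  simp [tensorFamily]

/-- The quadratic form `⟨φ|M|φ⟩`. -/
def expectation (M : QuditOp d n) (φ : Qudits d n) : ℂ :=
  star (fun a => φ a) ⬝ᵥ M.mulVec fun a => φ a

lemma expectation_act (M T : QuditOp d n) (φ : Qudits d n) :
    expectation M (act T φ) = expectation (T.conjTranspose * M * T) φ := by
  have h : (fun a => act T φ a) = T.mulVec fun a => φ a := rfl
  rw [expectation, expectation, h, Matrix.star_mulVec, ← Matrix.dotProduct_mulVec,
    Matrix.mulVec_mulVec, Matrix.mulVec_mulVec, Matrix.mul_assoc]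

lemma expectation_one (φ : Qudits d n) : expectation 1 φ = (‖φ‖ : ℂ) ^ 2 := by
  have h := inner_self_eq_norm_sq_to_K (𝕜 := ℂ) φ
  rw [EuclideanSpace.inner_eq_star_dotProduct] at h
  rw [expectation, Matrix.one_mulVec, dotProduct_comm]
  exact h

/-- The sum over all qudits of the expectation value of the observable `X`. -/
def localExpectation (X : Matrix (Fin d) (Fin d) ℂ) (φ : Qudits d n) : ℂ :=
  ∑ q, expectation (tensorFamily (Function.update (fun _ => 1) q X)) φ

lemma localExpectation_eq (X : Matrix (Fin d) (Fin d) ℂ) (φ : Qudits d n) :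
    localExpectation X φ =
      ∑ q, ∑ a : Fin n → Fin d, ∑ x, star (φ a) * (X (a q) x * φ (Function.update a q x)) := by
  refine Finset.sum_congr rfl fun q _ => Finset.sum_congr rfl fun a _ => ?_
  rw [Matrix.mulVec, dotProduct, ← Finset.mul_sum]
  congr 1
  have h2 : ∑ x, X (a q) x * φ (Function.update a q x) =
      ∑ x, X (a q) (Function.update a q x q) * φ (Function.update a q x) := by simp
  rw [h2, ← sum_prod_one_erase q a fun c => X (a q) (c q) * φ c]
  refine Finset.sum_congr rfl fun c _ => ?_
  rw [tensorFamily, Matrix.of_apply, ← Finset.prod_erase_mul _ _ (Finset.mem_univ q),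
    Function.update_self, mul_assoc]
  congr 1
  exact Finset.prod_congr rfl fun r hr => by
    rw [Function.update_of_ne (Finset.ne_of_mem_erase hr)]

lemma tensorPow_conjTranspose_mul_self (U : Matrix.unitaryGroup (Fin d) ℂ) :
    (tensorPow n U.1).conjTranspose * tensorPow n U.1 = 1 := by
  have hU : U.1.conjTranspose * U.1 = 1 := Unitary.coe_star_mul_self U
  have h : tensorPow n U.1 = tensorFamily fun _ => U.1 := rfl
  rw [h, tensorFamily_conjTranspose, tensorFamily_mul, hU, tensorFamily_one]

lemma norm_act_tensorPow (U : Matrix.unitaryGroup (Fin d) ℂ) (φ : Qudits d n) :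
    ‖act (tensorPow n U.1) φ‖ = ‖φ‖ := by
  have h := expectation_act 1 (tensorPow n U.1) φ
  rw [Matrix.mul_one, tensorPow_conjTranspose_mul_self, expectation_one, expectation_one] at h
  exact (sq_eq_sq₀ (norm_nonneg _) (norm_nonneg _)).mp (by exact_mod_cast h)

/-- On each idle qudit `U†U = 1`; only the observed one sees the conjugation. -/
lemma localExpectation_act_tensorPow (X : Matrix (Fin d) (Fin d) ℂ)
    (U : Matrix.unitaryGroup (Fin d) ℂ) (φ : Qudits d n) :
    localExpectation X (act (tensorPow n U.1) φ) =
      localExpectation (U.1.conjTranspose * X * U.1) φ := by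
  have hU : U.1.conjTranspose * U.1 = 1 := Unitary.coe_star_mul_self U
  have h : tensorPow n U.1 = tensorFamily fun _ => U.1 := rfl
  refine Finset.sum_congr rfl fun q _ => ?_
  rw [expectation_act, h, tensorFamily_conjTranspose, tensorFamily_mul, tensorFamily_mul]
  congr 2
  funext r
  rcases eq_or_ne r q with rfl | hr
  · simp
  · simp [hr, hU]

lemma apply_eq_zero_of_mem_weightSpace {w : Fin d → ℕ} {τ : Qudits d n}
    (hτ : τ ∈ weightSpace n w) {a : Fin n → Fin d} (ha : weight a ≠ w) : τ a = 0 := by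
  induction hτ using Submodule.span_induction with
  | mem x hx =>
    obtain ⟨b, hb, rfl⟩ := hx
    have : a ≠ b := by rintro rfl; exact ha hb
    simp [ket, this]
  | zero => rfl
  | add x y _ _ hx hy => simp [hx, hy]
  | smul c x _ hx => simp [hx]

/-- The positions carrying the symbol `x` strictly increase: they gain `q`. -/
lemma weight_update_ne (a : Fin n → Fin d) {q : Fin n} {x : Fin d} (hx : x ≠ a q) :
    weight (Function.update a q x) ≠ weight a := by
  intro h
  have h := congrFun h x
  refine (Finset.card_lt_card ((Finset.ssubset_iff_of_subset fun r hr => ?_).mpr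
    ⟨q, ?_, ?_⟩)).ne' h
  · simp only [Finset.mem_filter, Finset.mem_univ, true_and] at hr ⊢
    rcases eq_or_ne r q with rfl | hrq
    · simp
    · simpa [hrq] using hr
  · simp
  · simpa using hx.symm

/-- An off-diagonal entry of `X` changes one symbol, hence the weight, and so contributes nothing.
The diagonal entries count the symbols. -/
lemma localExpectation_of_mem_weightSpace (X : Matrix (Fin d) (Fin d) ℂ) {w : Fin d → ℕ}
    {τ : Qudits d n} (hτ : τ ∈ weightSpace n w) :
    localExpectation X τ = (∑ i, (w i : ℂ) * X i i) * (‖τ‖ : ℂ) ^ 2 := by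
  rw [localExpectation_eq, ← expectation_one, expectation, Matrix.one_mulVec, dotProduct,
    Finset.sum_comm, Finset.mul_sum]
  refine Finset.sum_congr rfl fun a _ => ?_
  by_cases ha : weight a = w
  · have h : ∀ q, ∑ x, star (τ a) * (X (a q) x * τ (Function.update a q x)) =
        X (a q) (a q) * (star (τ a) * τ a) := by
      intro q
      rw [Finset.sum_eq_single (a q)]
      · rw [Function.update_eq_self]; ring
      · intro x _ hx
        rw [apply_eq_zero_of_mem_weightSpace hτ
          fun h => weight_update_ne a hx (h.trans ha.symm)]
        simp
      · simp
    simp_rw [h, ← Finset.sum_mul]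
    congr 1
    rw [← Finset.sum_fiberwise _ a]
    refine Finset.sum_congr rfl fun i _ => ?_
    rw [Finset.sum_congr rfl fun q hq => (by rw [(Finset.mem_filter.mp hq).2] :
      X (a q) (a q) = X i i), Finset.sum_const, ← ha, nsmul_eq_mul]
    rfl
  · simp [apply_eq_zero_of_mem_weightSpace hτ ha]

end Operators

/-! ### Moments of independent Haar random pure states -/

section ProductMoments

variable {d : ℕ} {κ : Type*} [Fintype κ]

instance : SecondCountableTopology (Matrix (Fin d) (Fin d) ℂ) :=
  inferInstanceAs (SecondCountableTopology (Fin d → Fin d → ℂ))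

instance : SecondCountableTopology (Matrix.unitaryGroup (Fin d) ℂ) :=
  TopologicalSpace.Subtype.secondCountableTopology _

variable [NeZero d]

omit [Fintype κ] in
lemma continuous_pi_pureState : Continuous
    fun (V : κ → Matrix.unitaryGroup (Fin d) ℂ) (i : κ) => pureState (V i) :=
  continuous_pi fun i => continuous_pureState.comp (continuous_apply i)

lemma pi_haarState_eq_map : (Measure.pi fun _ : κ => haarState d) =
    (Measure.pi fun _ : κ => haarUnitary d).map fun V i => pureState (V i) := by
  have : SigmaFinite ((haarUnitary d).map pureState) :=
    inferInstanceAs (SigmaFinite (haarState d))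
  exact (Measure.pi_map_pi fun _ => continuous_pureState.measurable.aemeasurable).symm

/-- The matrix space is not compact, but the measure is pushed forward from a power of the compact
unitary group, where continuous functions are integrable. -/
lemma integrable_pi_haarState {g : (κ → Matrix (Fin d) (Fin d) ℂ) → ℂ} (hg : Continuous g) :
    Integrable g (Measure.pi fun _ : κ => haarState d) := by
  rw [pi_haarState_eq_map, integrable_map_measure hg.measurable.aestronglyMeasurable
    continuous_pi_pureState.measurable.aemeasurable]
  have h := hg.comp continuous_pi_pureState
  exact h.integrable_of_hasCompactSupport (HasCompactSupport.of_compactSpace _)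

variable {ι : Type*} [Fintype ι] [DecidableEq κ] (r : ι → κ)

/-- The matrix entry at `(a, b)` of the expectation of `⨂_q ψ_{r(q)}` over independent Haar
random pure states `ψ_i`. -/
def productMoment (a b : ι → Fin d) : ℂ :=
  ∏ i, moment (fun q : {q // r q = i} => a q) (fun q => b q)

lemma integral_prod_eq_productMoment (a b : ι → Fin d) :
    ∫ ψ, ∏ q, ψ (r q) (a q) (b q) ∂(Measure.pi fun _ : κ => haarState d) =
      productMoment r a b := by
  have h : ∀ ψ : κ → Matrix (Fin d) (Fin d) ℂ, ∏ q, ψ (r q) (a q) (b q) =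
      ∏ i, ∏ q : {q // r q = i}, ψ i (a q) (b q) := by
    intro ψ
    rw [← Fintype.prod_fiberwise r]
    exact Finset.prod_congr rfl fun i _ => Finset.prod_congr rfl fun q _ => by rw [q.2]
  simp_rw [h]
  exact integral_fintype_prod_eq_prod (𝕜 := ℂ) (μ := fun _ : κ => haarState d)
    (fun i (M : Matrix (Fin d) (Fin d) ℂ) => ∏ q : {q // r q = i}, M (a q) (b q))

variable [DecidableEq ι]

/-- The normalized product moment is the product of the symmetric projections of the fibres of `r`,
that is, the average over fibre-preserving permutations, so it fixes `φ`. -/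
lemma sum_productMoment_mul {φ : (ι → Fin d) → ℂ}
    (hφ : ∀ π : Equiv.Perm ι, (∀ q, r (π q) = r q) → ∀ a, φ (a ∘ π) = φ a) (a : ι → Fin d) :
    (∏ i, (kappa d (Fintype.card {q // r q = i}) : ℂ)) * ∑ b, productMoment r a b * φ b =
      φ a := by
  -- A choice of one permutation on each fibre assembles into a permutation of `ι` that preserves
  -- the fibres.
  let glue (p : ∀ i, Equiv.Perm {q // r q = i}) : Equiv.Perm ι :=
    (Equiv.sigmaFiberEquiv r).permCongr (Equiv.sigmaCongrRight p)
  have hglue : ∀ p q, glue p q = p (r q) ⟨q, rfl⟩ := fun p q => rfl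
  have hinv : ∀ p, φ (a ∘ glue p) = φ a := fun p =>
    hφ _ (fun q => by rw [hglue]; exact (p (r q) ⟨q, rfl⟩).2) a
  have hb : ∀ b, (∏ i, (kappa d (Fintype.card {q // r q = i}) : ℂ)) * productMoment r a b =
      (∏ i, ((Fintype.card {q // r q = i}).factorial : ℂ)⁻¹) *
        ∑ p : ∀ i, Equiv.Perm {q // r q = i}, if b = a ∘ glue p then 1 else 0 := by
    intro b
    rw [productMoment, ← Finset.prod_mul_distrib]
    simp_rw [kappa_mul_moment, Finset.prod_mul_distrib]
    congr 1
    rw [Finset.prod_univ_sum, Fintype.piFinset_univ]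
    refine Finset.sum_congr rfl fun p _ => ?_
    rw [Finset.prod_ite_zero, Finset.prod_const_one]
    by_cases h : b = a ∘ glue p
    · rw [if_pos h, if_pos]
      rintro i -
      funext ⟨q, hq⟩
      subst hq h
      rfl
    · rw [if_neg h, if_neg]
      refine fun h' => h (funext fun q => ?_)
      exact (congrFun (h' (r q) (Finset.mem_univ _)) ⟨q, rfl⟩).symm
  rw [Finset.mul_sum]
  simp_rw [← mul_assoc, hb, mul_assoc, ← Finset.mul_sum, Finset.sum_mul]
  rw [Finset.sum_comm]
  simp only [ite_mul, one_mul, zero_mul, Finset.sum_ite_eq', Finset.mem_univ, if_true, hinv,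
    Finset.sum_const, Finset.card_univ, Fintype.card_pi, Fintype.card_perm, nsmul_eq_mul]
  push_cast
  rw [← mul_assoc, ← Finset.prod_mul_distrib, Finset.prod_eq_one, one_mul]
  exact fun i _ => inv_mul_cancel₀ (by exact_mod_cast Nat.factorial_ne_zero _)

/-- The extra `ψ i x y` acts as an additional qudit `none` in the fibre over `i`, to which
`moment_option` applies. The term `o = none` gives the delta, `o = some q` the swap with `q`; by
independence the other fibres are untouched. -/
lemma add_mul_integral_mul_prod (i : κ) (x y : Fin d) (a b : ι → Fin d) :
    ((d : ℂ) + Fintype.card {q // r q = i}) *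
        ∫ ψ, ψ i x y * ∏ q, ψ (r q) (a q) (b q) ∂(Measure.pi fun _ : κ => haarState d) =
      (if x = y then productMoment r a b else 0) +
        ∑ q : {q // r q = i}, if a q = y then productMoment r (Function.update a q x) b else 0 := by
  have h : ∀ ψ : κ → Matrix (Fin d) (Fin d) ℂ, ψ i x y * ∏ q, ψ (r q) (a q) (b q) =
      ∏ j, (if j = i then ψ j x y else 1) * ∏ q : {q // r q = j}, ψ j (a q) (b q) := by
    intro ψ
    rw [← Fintype.prod_fiberwise r, Finset.prod_mul_distrib, Finset.prod_ite_eq' Finset.univ i,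
      if_pos (Finset.mem_univ i)]
    congr 1
    exact Finset.prod_congr rfl fun i _ => Finset.prod_congr rfl fun q _ => by rw [q.2]
  have hP : ∀ a : ι → Fin d, productMoment r a b =
      moment (fun q : {q // r q = i} => a q) (fun q => b q) *
        ∏ j ∈ Finset.univ.erase i, moment (fun q : {q // r q = j} => a q) (fun q => b q) :=
    fun a => (Finset.mul_prod_erase _ _ (Finset.mem_univ i)).symm
  have hrest : ∀ q : {q // r q = i},
      ∏ j ∈ Finset.univ.erase i,
        moment (fun s : {s // r s = j} => Function.update a q x s) (fun s => b s) =
      ∏ j ∈ Finset.univ.erase i, moment (fun s : {s // r s = j} => a s) (fun s => b s) := by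
    intro q
    refine Finset.prod_congr rfl fun j hj => ?_
    congr 1
    funext s
    refine Function.update_of_ne (fun hs => Finset.ne_of_mem_erase hj ?_) _ _
    rw [← s.2, hs, q.2]
  have hI : ∫ ψ, ∏ j, (if j = i then ψ j x y else 1) * ∏ q : {q // r q = j}, ψ j (a q) (b q)
        ∂(Measure.pi fun _ : κ => haarState d) =
      moment (fun o : Option {q // r q = i} => o.elim x fun q => a q)
          (fun o => o.elim y fun q => b q) *
        ∏ j ∈ Finset.univ.erase i, moment (fun q : {q // r q = j} => a q) (fun q => b q) := by
    refine (integral_fintype_prod_eq_prod (𝕜 := ℂ) (μ := fun _ : κ => haarState d)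
      (fun j (M : Matrix (Fin d) (Fin d) ℂ) =>
        (if j = i then M x y else 1) * ∏ q : {q // r q = j}, M (a q) (b q))).trans ?_
    rw [← Finset.mul_prod_erase _ _ (Finset.mem_univ i)]
    congr 1
    · simp [moment, Fintype.prod_option]
    · refine Finset.prod_congr rfl fun j hj => ?_
      simp [moment, Finset.ne_of_mem_erase hj]
  simp_rw [h]
  rw [hI, ← mul_assoc, moment_option, Fintype.sum_option, add_mul, Finset.sum_mul]
  congr 1
  · rw [hP, ite_mul, zero_mul]
    refine if_congr Iff.rfl ?_ rfl
    congr 2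
  · refine Finset.sum_congr rfl fun q _ => ?_
    rw [hP, hrest, ite_mul, zero_mul]
    refine if_congr Iff.rfl ?_ rfl
    congr 2
    funext s
    rcases eq_or_ne s q with rfl | hs
    · simp
    · simp [hs, Subtype.val_injective.ne hs, Equiv.swap_apply_of_ne_of_ne]

end ProductMoments

lemma DPartition.card_row {d n : ℕ} (lam : DPartition d n) (i : Fin lam.length) :
    Fintype.card {q // lam.row q = i} = lam.part i := by
  rw [← Fintype.card_fin (lam.part i)]
  refine Fintype.card_congr (Equiv.ofBijective (fun s : Fin (lam.part i) =>
    (⟨lam.toComposition.embedding i s, lam.toComposition.index_embedding i s⟩ :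
      {q // lam.row q = i})) ⟨fun s t h => ?_, ?_⟩).symm
  · exact (lam.toComposition.embedding i).injective (congrArg Subtype.val h)
  · rintro ⟨q, rfl⟩
    exact ⟨lam.toComposition.invEmbedding q, Subtype.ext (lam.toComposition.embedding_comp_inv q)⟩

/-! ### The row symmetric measurement on row symmetric states -/

section Measurement

variable {d n : ℕ}

lemma trace_rowPOVM (lam : DPartition d n) (φ : Qudits d n)
    (ψ : Fin lam.length → Matrix (Fin d) (Fin d) ℂ) :
    (rowPOVM lam ψ * stateMatrix φ).trace =
      ∑ a : Fin n → Fin d, ∑ b : Fin n → Fin d, (∏ i, (kappa d (lam.part i) : ℂ)) *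
        (φ b * star (φ a)) * ∏ q, ψ (lam.row q) (a q) (b q) := by
  simp only [Matrix.trace, Matrix.diag, Matrix.mul_apply, rowPOVM, Matrix.smul_apply, stateMatrix,
    Matrix.of_apply, Matrix.vecMulVec_apply, smul_eq_mul]
  exact Finset.sum_congr rfl fun a _ => Finset.sum_congr rfl fun b _ => by ring

lemma continuous_trace_rowPOVM (lam : DPartition d n) (φ : Qudits d n) :
    Continuous fun ψ : Fin lam.length → Matrix (Fin d) (Fin d) ℂ =>
      (rowPOVM lam ψ * stateMatrix φ).trace := by
  simp_rw [trace_rowPOVM]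
  fun_prop

variable [NeZero d]

/-- On pure states the POVM element has rank one up to scale, so the Born weight is a squared
modulus. -/
lemma trace_rowPOVM_pureState (lam : DPartition d n) (φ : Qudits d n)
    (V : Fin lam.length → Matrix.unitaryGroup (Fin d) ℂ) :
    (rowPOVM lam (fun i => pureState (V i)) * stateMatrix φ).trace =
      (((∏ i, (kappa d (lam.part i) : ℝ)) *
        Complex.normSq (∑ a : Fin n → Fin d, (∏ q, (V (lam.row q)).1 (a q) 0) * star (φ a)) : ℝ) :
          ℂ) := by
  rw [trace_rowPOVM, Complex.ofReal_mul, Complex.normSq_eq_conj_mul_self, map_sum,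
    Finset.mul_sum, mul_comm, Finset.sum_mul]
  push_cast
  refine Finset.sum_congr rfl fun a _ => ?_
  simp only [Finset.sum_mul]
  refine Finset.sum_congr rfl fun b _ => ?_
  simp only [pureState_apply, Finset.prod_mul_distrib, map_mul, map_prod, Complex.star_def,
    Complex.conj_conj]
  ring

/-- The law truncates the Born weight by `re` and `ENNReal.ofReal`. Both are harmless almost
everywhere, since `μ_H` lives on pure states. -/
lemma ae_trace_rowPOVM (lam : DPartition d n) (φ : Qudits d n) :
    ∀ᵐ ψ ∂(Measure.pi fun _ : Fin lam.length => haarState d),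
      0 ≤ (rowPOVM lam ψ * stateMatrix φ).trace.re ∧
        ((rowPOVM lam ψ * stateMatrix φ).trace.re : ℂ) = (rowPOVM lam ψ * stateMatrix φ).trace := by
  have hc := continuous_trace_rowPOVM lam φ
  have hre := Complex.continuous_re.comp hc
  have hmeas : MeasurableSet {ψ : Fin lam.length → Matrix (Fin d) (Fin d) ℂ |
      0 ≤ (rowPOVM lam ψ * stateMatrix φ).trace.re ∧
        ((rowPOVM lam ψ * stateMatrix φ).trace.re : ℂ) =
          (rowPOVM lam ψ * stateMatrix φ).trace} :=
    (measurableSet_le measurable_const hre.measurable).inter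
      (measurableSet_eq_fun (Complex.continuous_ofReal.comp hre).measurable hc.measurable)
  rw [pi_haarState_eq_map, ae_map_iff continuous_pi_pureState.measurable.aemeasurable hmeas]
  refine Filter.Eventually.of_forall fun V => ?_
  rw [trace_rowPOVM_pureState, Complex.ofReal_re]
  exact ⟨mul_nonneg (Finset.prod_nonneg fun _ _ => Nat.cast_nonneg _) (Complex.normSq_nonneg _), rfl⟩

variable {lam : DPartition d n} {φ : Qudits d n}

lemma sum_productMoment_row (hφ : ∀ π ∈ lam.rowPerms, ∀ a, φ (a ∘ π) = φ a)
    (a : Fin n → Fin d) :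
    (∏ i, (kappa d (lam.part i) : ℂ)) * ∑ b, productMoment lam.row a b * φ b = φ a := by
  have h := sum_productMoment_mul lam.row (φ := fun a => φ a)
    (fun π hπ => hφ π (by simpa [DPartition.rowPerms] using hπ)) a
  simpa only [lam.card_row] using h

lemma integral_trace_rowPOVM (hφ : ∀ π ∈ lam.rowPerms, ∀ a, φ (a ∘ π) = φ a) :
    ∫ ψ, (rowPOVM lam ψ * stateMatrix φ).trace
      ∂(Measure.pi fun _ : Fin lam.length => haarState d) = (‖φ‖ : ℂ) ^ 2 := by
  simp_rw [trace_rowPOVM]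
  rw [integral_finsetSum _ fun a _ => integrable_pi_haarState (by fun_prop),
    ← expectation_one, expectation, Matrix.one_mulVec, dotProduct]
  refine Finset.sum_congr rfl fun a _ => ?_
  rw [integral_finsetSum _ fun b _ => integrable_pi_haarState (by fun_prop)]
  simp_rw [integral_const_mul, integral_prod_eq_productMoment]
  conv_rhs => rw [← sum_productMoment_row hφ a]
  simp only [Pi.star_apply, Finset.mul_sum]
  exact Finset.sum_congr rfl fun b _ => by ring

/-- The inner sum over `a` is the `(x, y)` entry of the reduced state of qudit `q`. The weight `d +
λ_i` cancels the denominator left by the extra copy of `ψ_i`. -/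
lemma add_mul_integral_mul_trace_rowPOVM (hφ : ∀ π ∈ lam.rowPerms, ∀ a, φ (a ∘ π) = φ a)
    (i : Fin lam.length) (x y : Fin d) :
    ((d : ℂ) + (lam.part i : ℂ)) * ∫ ψ, ψ i x y * (rowPOVM lam ψ * stateMatrix φ).trace
        ∂(Measure.pi fun _ : Fin lam.length => haarState d) =
      (if x = y then (‖φ‖ : ℂ) ^ 2 else 0) +
        ∑ q : {q // lam.row q = i}, ∑ a : Fin n → Fin d,
          if a q = y then star (φ a) * φ (Function.update a q x) else 0 := by
  have hterm : ∀ a b : Fin n → Fin d, ((d : ℂ) + (lam.part i : ℂ)) *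
      ∫ ψ, ψ i x y * ((∏ i, (kappa d (lam.part i) : ℂ)) * (φ b * star (φ a)) *
        ∏ q, ψ (lam.row q) (a q) (b q)) ∂(Measure.pi fun _ : Fin lam.length => haarState d) =
      star (φ a) * ((if x = y then
          (∏ i, (kappa d (lam.part i) : ℂ)) * (productMoment lam.row a b * φ b) else 0) +
        ∑ q : {q // lam.row q = i}, if a q = y then (∏ i, (kappa d (lam.part i) : ℂ)) *
          (productMoment lam.row (Function.update a q x) b * φ b) else 0) := by
    intro a b
    simp_rw [mul_left_comm (_ : ℂ) (_ * _) _, integral_const_mul]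
    have h := add_mul_integral_mul_prod lam.row i x y a b
    rw [lam.card_row] at h
    rw [mul_left_comm, h]
    simp only [mul_add, Finset.mul_sum, mul_ite, mul_zero]
    congr 1
    · exact if_congr Iff.rfl (by ring) rfl
    · exact Finset.sum_congr rfl fun q _ => if_congr Iff.rfl (by ring) rfl
  simp_rw [trace_rowPOVM, Finset.mul_sum]
  rw [integral_finsetSum _ fun a _ => integrable_pi_haarState (by fun_prop), Finset.mul_sum]
  have ha : ∀ a : Fin n → Fin d, ((d : ℂ) + (lam.part i : ℂ)) *
      ∫ ψ, ∑ b : Fin n → Fin d, ψ i x y * ((∏ i, (kappa d (lam.part i) : ℂ)) *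
        (φ b * star (φ a)) * ∏ q, ψ (lam.row q) (a q) (b q))
          ∂(Measure.pi fun _ : Fin lam.length => haarState d) =
      (if x = y then star (φ a) * φ a else 0) + ∑ q : {q // lam.row q = i},
        if a q = y then star (φ a) * φ (Function.update a q x) else 0 := by
    intro a
    rw [integral_finsetSum _ fun b _ => integrable_pi_haarState (by fun_prop), Finset.mul_sum,
      Finset.sum_congr rfl fun b _ => hterm a b, ← Finset.mul_sum, Finset.sum_add_distrib,
      Finset.sum_comm]
    -- Row symmetry of `φ` collapses the sum over `b` both at `a` and at each updated tuple, which
    -- need not have the same weight.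
    simp only [Finset.sum_ite_irrel, Finset.sum_const_zero, ← Finset.mul_sum,
      sum_productMoment_row hφ]
    simp only [mul_add, Finset.mul_sum, mul_ite, mul_zero]
  rw [Finset.sum_congr rfl fun a _ => ha a, Finset.sum_add_distrib, Finset.sum_comm,
    Finset.sum_ite_irrel, Finset.sum_const_zero, ← expectation_one, expectation,
    Matrix.one_mulVec]
  rfl

/-- The rows partition the boxes, so the row sums of reduced states add up to the sum over all
qudits. The entry `(x, y)` of a reduced state is the expectation of `|y⟩⟨x|`, whence the reversed
indices in `Matrix.single y x 1`. -/
lemma integral_shadow_mul_trace_rowPOVM (hφ : ∀ π ∈ lam.rowPerms, ∀ a, φ (a ∘ π) = φ a)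
    (x y : Fin d) :
    ∫ ψ, shadow lam (Sum.inl ψ) x y * (rowPOVM lam ψ * stateMatrix φ).trace
        ∂(Measure.pi fun _ : Fin lam.length => haarState d) =
      lam.length * (if x = y then (‖φ‖ : ℂ) ^ 2 else 0) +
        localExpectation (Matrix.single y x 1) φ := by
  have hc := continuous_trace_rowPOVM lam φ
  simp only [shadow, Matrix.sum_apply, Matrix.smul_apply, smul_eq_mul, Finset.sum_mul, mul_assoc]
  rw [integral_finsetSum _ fun i _ => integrable_pi_haarState (by fun_prop)]
  simp_rw [integral_const_mul, add_mul_integral_mul_trace_rowPOVM hφ]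
  rw [Finset.sum_add_distrib, Finset.sum_const, Finset.card_univ, Fintype.card_fin, nsmul_eq_mul,
    Fintype.sum_fiberwise lam.row fun q => ∑ a : Fin n → Fin d,
          if a q = y then star (φ a) * φ (Function.update a q x) else 0, localExpectation_eq]
  congr 1
  refine Finset.sum_congr rfl fun q _ => Finset.sum_congr rfl fun a _ => ?_
  simp [Matrix.single_apply, ite_and, eq_comm]

lemma lintegral_trace_rowPOVM (hφ : ∀ π ∈ lam.rowPerms, ∀ a, φ (a ∘ π) = φ a) (h1 : ‖φ‖ = 1) :
    ∫⁻ ψ, ENNReal.ofReal (rowPOVM lam ψ * stateMatrix φ).trace.re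
      ∂(Measure.pi fun _ : Fin lam.length => haarState d) = 1 := by
  have hae := ae_trace_rowPOVM lam φ
  have h : ((∫ ψ, (rowPOVM lam ψ * stateMatrix φ).trace.re
      ∂(Measure.pi fun _ : Fin lam.length => haarState d) : ℝ) : ℂ) = 1 := by
    rw [← integral_complex_ofReal, integral_congr_ae (hae.mono fun ψ hψ => hψ.2),
      integral_trace_rowPOVM hφ, h1]
    simp
  have hint : Integrable (fun ψ => (rowPOVM lam ψ * stateMatrix φ).trace.re)
      (Measure.pi fun _ : Fin lam.length => haarState d) :=
    (integrable_pi_haarState (continuous_trace_rowPOVM lam φ)).re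
  rw [← ofReal_integral_eq_lintegral_ofReal hint (hae.mono fun ψ hψ => hψ.1),
    Complex.ofReal_eq_one.mp h, ENNReal.ofReal_one]

lemma outcomeLaw_eq_map (hφ : ∀ π ∈ lam.rowPerms, ∀ a, φ (a ∘ π) = φ a) :
    outcomeLaw lam φ = ((Measure.pi fun _ : Fin lam.length => haarState d).withDensity fun ψ =>
      ENNReal.ofReal (rowPOVM lam ψ * stateMatrix φ).trace.re).map Sum.inl := by
  rw [outcomeLaw, one_sub_symProj_mul_stateMatrix hφ]
  simp

lemma isProbabilityMeasure_outcomeLaw (hφ : ∀ π ∈ lam.rowPerms, ∀ a, φ (a ∘ π) = φ a)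
    (h1 : ‖φ‖ = 1) : IsProbabilityMeasure (outcomeLaw lam φ) := by
  constructor
  rw [outcomeLaw_eq_map hφ, Measure.map_apply measurable_inl MeasurableSet.univ,
    Set.preimage_univ, withDensity_apply _ MeasurableSet.univ, Measure.restrict_univ,
    lintegral_trace_rowPOVM hφ h1]

lemma outcomeLaw_fail (hφ : ∀ π ∈ lam.rowPerms, ∀ a, φ (a ∘ π) = φ a) :
    outcomeLaw lam φ {Sum.inr ()} = 0 := by
  have h : (Sum.inl ⁻¹' {Sum.inr ()} : Set (Fin lam.length → Matrix (Fin d) (Fin d) ℂ)) = ∅ := by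
    ext; simp
  rw [outcomeLaw_eq_map hφ, Measure.map_apply measurable_inl, h, measure_empty]
  rw [← Set.image_singleton]
  exact (MeasurableSet.singleton ()).inr_image

omit [NeZero d] in
lemma measurable_ofReal_trace_rowPOVM (lam : DPartition d n) (φ : Qudits d n) :
    Measurable fun ψ : Fin lam.length → Matrix (Fin d) (Fin d) ℂ =>
      ENNReal.ofReal (rowPOVM lam ψ * stateMatrix φ).trace.re :=
  (Complex.continuous_re.comp (continuous_trace_rowPOVM lam φ)).measurable.ennreal_ofReal

lemma measurableEmbedding_sumInl {α β : Type*} [MeasurableSpace α] [MeasurableSpace β] :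
    MeasurableEmbedding (Sum.inl : α → α ⊕ β) :=
  ⟨Sum.inl_injective, measurable_inl, fun _ => MeasurableSet.inl_image⟩

lemma ae_smul_shadow (lam : DPartition d n) (φ : Qudits d n) (x y : Fin d) :
    (fun ψ => (ENNReal.ofReal (rowPOVM lam ψ * stateMatrix φ).trace.re).toReal •
        shadow lam (Sum.inl ψ) x y) =ᵐ[Measure.pi fun _ : Fin lam.length => haarState d]
      fun ψ => shadow lam (Sum.inl ψ) x y * (rowPOVM lam ψ * stateMatrix φ).trace := by
  filter_upwards [ae_trace_rowPOVM lam φ] with ψ hψ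
  rw [ENNReal.toReal_ofReal hψ.1, Complex.real_smul, hψ.2, mul_comm]

lemma integrable_shadow (hφ : ∀ π ∈ lam.rowPerms, ∀ a, φ (a ∘ π) = φ a) (x y : Fin d) :
    Integrable (fun o => shadow lam o x y) (outcomeLaw lam φ) := by
  rw [outcomeLaw_eq_map hφ, measurableEmbedding_sumInl.integrable_map_iff, Function.comp_def,
    integrable_withDensity_iff_integrable_smul' (measurable_ofReal_trace_rowPOVM lam φ)
      (Filter.Eventually.of_forall fun _ => ENNReal.ofReal_lt_top),
    integrable_congr (ae_smul_shadow lam φ x y)]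
  have hc := continuous_trace_rowPOVM lam φ
  refine integrable_pi_haarState ?_
  simp only [shadow, Matrix.sum_apply, Matrix.smul_apply]
  fun_prop

lemma integral_shadow (hφ : ∀ π ∈ lam.rowPerms, ∀ a, φ (a ∘ π) = φ a) (x y : Fin d) :
    ∫ o, shadow lam o x y ∂(outcomeLaw lam φ) =
      lam.length * (if x = y then (‖φ‖ : ℂ) ^ 2 else 0) +
        localExpectation (Matrix.single y x 1) φ := by
  rw [outcomeLaw_eq_map hφ, measurableEmbedding_sumInl.integral_map,
    integral_withDensity_eq_integral_toReal_smul (measurable_ofReal_trace_rowPOVM lam φ)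
      (Filter.Eventually.of_forall fun _ => ENNReal.ofReal_lt_top),
    integral_congr_ae (ae_smul_shadow lam φ x y), integral_shadow_mul_trace_rowPOVM hφ]

end Measurement
end RowSym

end

open RowSym
theorem mainTheorem5 {d n : ℕ} [NeZero d]
    (v : SchurFamily d n) (hv : IsNiceSchurBasis v)
    (U : Matrix.unitaryGroup (Fin d) ℂ) (e : Fin n → Fin d)
    (lam : DPartition d n) (τ : Qudits d n)
    (hout : IsPreprocessingOutput v
      (act (tensorPow n (U : Matrix (Fin d) (Fin d) ℂ)) (ket e)) lam
      (act (tensorPow n (U : Matrix (Fin d) (Fin d) ℂ)) τ))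
    (w : Fin d → ℕ) (hτ : τ ∈ weightSpace n w) :
    MeasureTheory.IsProbabilityMeasure (outcomeLaw lam
      (act (tensorPow n (U : Matrix (Fin d) (Fin d) ℂ)) τ)) ∧
    outcomeLaw lam (act (tensorPow n (U : Matrix (Fin d) (Fin d) ℂ)) τ) {Sum.inr ()} = 0 ∧
    (∀ a b : Fin d, MeasureTheory.Integrable (fun o => shadow lam o a b)
      (outcomeLaw lam (act (tensorPow n (U : Matrix (Fin d) (Fin d) ℂ)) τ))) ∧
    (Matrix.of fun a b : Fin d => ∫ o, shadow lam o a b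
        ∂(outcomeLaw lam (act (tensorPow n (U : Matrix (Fin d) (Fin d) ℂ)) τ))) =
      (lam.length : ℂ) • (1 : Matrix (Fin d) (Fin d) ℂ) +
        ∑ i : Fin d, (w i : ℂ) •
          ((U : Matrix (Fin d) (Fin d) ℂ) * Matrix.single i i 1 *
            (U : Matrix (Fin d) (Fin d) ℂ).conjTranspose) := by
  obtain ⟨hmem, hnorm⟩ := hout.mem_and_norm hv
  -- Normalization is known for the output `U^{⊗n} τ` and passes to `τ` because `U^{⊗n}` is an
  -- isometry.
  have hτ1 : ‖τ‖ = 1 := (norm_act_tensorPow U τ).symm.trans hnorm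
  have hsym := fun π hπ => apply_comp_of_mem_canonicalIrrep (π := π) hmem hπ
  refine ⟨isProbabilityMeasure_outcomeLaw hsym hnorm, outcomeLaw_fail hsym,
    integrable_shadow hsym, ?_⟩
  ext x y
  rw [Matrix.of_apply, integral_shadow hsym, hnorm, localExpectation_act_tensorPow,
    localExpectation_of_mem_weightSpace _ hτ, hτ1]
  simp only [Matrix.add_apply, Matrix.smul_apply, Matrix.sum_apply, Matrix.one_apply, smul_eq_mul,
    Complex.ofReal_one, one_pow, mul_one]
  congr 1
  refine Finset.sum_congr rfl fun i _ => ?_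
  congr 1
  -- The `i`-th diagonal entry of `U†|y⟩⟨x|U` is the `(x, y)` entry of `U|i⟩⟨i|U†`.
  simp [Matrix.mul_apply, Matrix.single_apply, ite_and, mul_comm]
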